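/- Work on $([0,\infty),\lambda)$ with Lebesgue measure $\lambda$. Let $M$ be the set of (a.e. classes of) extended complex-valued measurable functions on $[0,\infty)$ and $M_+$ its subset of functions with values in $[0,\infty]$. For $f\in M$ let $\lambda_f(s)=\lambda(\{|f|>s\})$, $s\ge 0$, be its distribution function and $f^*(t)=\inf\{s\in[0,\infty):\lambda_f(s)\le t\}$, $t\ge 0$, its non-increasing rearrangement. A functional $\|\cdot\|:M\to[0,\infty]$ with $\|f\|=\||f|\|$ is a quasi-Banach function norm if on $M_+$ - (Q1) $\|af\|=|a|\,\|f\|$ for $a\in\mathbb C$; $\|f\|=0$ iff $f=0$ a.e.; and for some constant $C\ge1$, $\|f+g\|\le C(\|f\|+\|g\|)$ for all $f,g$; - (P2) $f\le g$ a.e. implies $\|f\|\le\|g\|$; - (P3) $f_n\uparrow f$ a.e. implies $\|f_n\|\uparrow\|f\|$; - (P4) $\|\chi_E\|<\infty$ whenever $\lambda(E)<\infty$. It is rearrangement-invariant (r.i.) if $\|f\|=\|g\|$ whenever $\lambda_f=\lambda_g$. It has property (P1) if (Q1) holds with $C=1$, and property (P5) if for every $E$ with $\lambda(E)<\infty$ there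 is a finite constant $C_E$ with $\int_E f\,d\lambda\le C_E\|f\|$ for all $f\in M_+$. The corresponding space is $\{f\in M:\|f\|<\infty\}$ with the topology defined by the quasinorm. For r.i. quasi-Banach function norms $\|\cdot\|_A,\|\cdot\|_B$, the Wiener--Luxemburg amalgam space $WL(A,B)$ is the space of the functional $$\|f\|_{WL(A,B)}=\|f^*\chi_{[0,1]}\|_A+\|f^*\chi_{(1,\infty)}\|_B .$$ Write $Y\hookrightarrow X$ if $Y\subseteq X$ and the identity map $Y\to X$ is continuous. **Theorem.** Let $\|\cdot\|_A$ be an r.i. quasi-Banach function norm over $([0,\infty),\lambda)$ and let $A$ be the corresponding space. Then 1. $WL(L^\infty,A)\hookrightarrow A$; 2. if $\|\cdot\|_A$ has property (P1), then $WL(A,L^1)\hookrightarrow A$; 3. $A\hookrightarrow WL(L^1,A)$ if and only if $\|\cdot\|_A$ has property (P5); 4. $A\hookrightarrow WL(A,L^\infty)$. -/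

import Mathlib

open MeasureTheory Set Filter Topology
open scoped ENNReal NNReal

noncomputable section

namespace WienerLuxemburg

variable {R : Type*} [MeasurableSpace R]

/-! ### Function norms

A functional `‖·‖` on (extended complex-valued) measurable functions with `‖f‖ = ‖|f|‖` is the same
thing as its restriction to `[0, ∞]`-valued measurable functions. We therefore describe it by a map
`ρ : (R → ℝ≥0∞) → ℝ≥0∞`, of which only the values at `μ`-a.e.-measurable functions are ever
constrained or used, and put `‖f‖ = ρ |f|` for general `f`. -/

/-- (P1): the functional is a norm. Here `|a f| = |a| f` for `f ≥ 0`, so that homogeneity only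
concerns scalars `|a| ∈ [0, ∞)`; the convention `0 * ∞ = 0` is in force. -/
structure HasP1 (μ : Measure R) (ρ : (R → ℝ≥0∞) → ℝ≥0∞) : Prop where
  homogeneous : ∀ (a : ℝ≥0) (f : R → ℝ≥0∞), AEMeasurable f μ →
    ρ (fun x => (a : ℝ≥0∞) * f x) = (a : ℝ≥0∞) * ρ f
  eq_zero_iff : ∀ f : R → ℝ≥0∞, AEMeasurable f μ → (ρ f = 0 ↔ f =ᵐ[μ] 0)
  subadditive : ∀ f g : R → ℝ≥0∞, AEMeasurable f μ → AEMeasurable g μ →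
    ρ (fun x => f x + g x) ≤ ρ f + ρ g

/-- (Q1): the functional is a quasinorm. -/
structure HasQ1 (μ : Measure R) (ρ : (R → ℝ≥0∞) → ℝ≥0∞) : Prop where
  homogeneous : ∀ (a : ℝ≥0) (f : R → ℝ≥0∞), AEMeasurable f μ →
    ρ (fun x => (a : ℝ≥0∞) * f x) = (a : ℝ≥0∞) * ρ f
  eq_zero_iff : ∀ f : R → ℝ≥0∞, AEMeasurable f μ → (ρ f = 0 ↔ f =ᵐ[μ] 0)
  quasi_subadditive : ∃ C : ℝ≥0, 1 ≤ C ∧ ∀ f g : R → ℝ≥0∞, AEMeasurable f μ → AEMeasurable g μ →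
    ρ (fun x => f x + g x) ≤ C * (ρ f + ρ g)

/-- (P2): the lattice property. -/
def HasP2 (μ : Measure R) (ρ : (R → ℝ≥0∞) → ℝ≥0∞) : Prop :=
  ∀ f g : R → ℝ≥0∞, AEMeasurable f μ → AEMeasurable g μ → f ≤ᵐ[μ] g → ρ f ≤ ρ g

/-- (P3): the Fatou property, `f_n ↑ f` a.e. implies `‖f_n‖ ↑ ‖f‖`. -/
def HasP3 (μ : Measure R) (ρ : (R → ℝ≥0∞) → ℝ≥0∞) : Prop :=
  ∀ (f : ℕ → R → ℝ≥0∞) (g : R → ℝ≥0∞), (∀ n, AEMeasurable (f n) μ) → AEMeasurable g μ →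
    (∀ᵐ x ∂μ, Monotone (fun n => f n x) ∧ Tendsto (fun n => f n x) atTop (𝓝 (g x))) →
    Monotone (fun n => ρ (f n)) ∧ Tendsto (fun n => ρ (f n)) atTop (𝓝 (ρ g))

/-- (P4): characteristic functions of sets of finite measure have finite norm. -/
def HasP4 (μ : Measure R) (ρ : (R → ℝ≥0∞) → ℝ≥0∞) : Prop :=
  ∀ E : Set R, MeasurableSet E → μ E < ∞ → ρ (E.indicator fun _ => 1) < ∞

/-- (P5): functions of finite norm are integrable over sets of finite measure, with a bound. -/
def HasP5 (μ : Measure R) (ρ : (R → ℝ≥0∞) → ℝ≥0∞) : Prop :=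
  ∀ E : Set R, MeasurableSet E → μ E < ∞ → ∃ C : ℝ≥0, ∀ f : R → ℝ≥0∞, AEMeasurable f μ →
    ∫⁻ x in E, f x ∂μ ≤ C * ρ f

/-- Quasi-Banach function norms. -/
structure IsQuasiBanachFunctionNorm (μ : Measure R) (ρ : (R → ℝ≥0∞) → ℝ≥0∞) : Prop where
  q1 : HasQ1 μ ρ
  p2 : HasP2 μ ρ
  p3 : HasP3 μ ρ
  p4 : HasP4 μ ρ

/-! ### Rearrangements -/

/-- The distribution function `s ↦ μ {x | f x > s}`, `s ∈ [0, ∞)`, of a nonnegative function. -/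
def distribution (μ : Measure R) (f : R → ℝ≥0∞) (s : ℝ≥0) : ℝ≥0∞ :=
  μ {x | (s : ℝ≥0∞) < f x}

/-- The non-increasing rearrangement `f^*(t) = inf {s ∈ [0, ∞) | μ_f(s) ≤ t}`, `t ∈ [0, ∞)`; the
infimum is taken in `[0, ∞]`, so that the infimum of the empty set is `∞`. -/
def rearrangement (μ : Measure R) (f : R → ℝ≥0∞) (t : ℝ≥0) : ℝ≥0∞ :=
  ⨅ (s : ℝ≥0) (_ : distribution μ f s ≤ t), (s : ℝ≥0∞)

/-- Rearrangement-invariant quasi-Banach function norms: equimeasurable functions have the same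
norm. -/
structure IsRIQuasiBanachFunctionNorm (μ : Measure R) (ρ : (R → ℝ≥0∞) → ℝ≥0∞) : Prop extends
    IsQuasiBanachFunctionNorm μ ρ where
  rearrangement_invariant : ∀ f g : R → ℝ≥0∞, AEMeasurable f μ → AEMeasurable g μ →
    distribution μ f = distribution μ g → ρ f = ρ g

/-! ### The associated spaces and their embeddings -/

/-- The norm `‖f‖ = ρ |f|` of an a.e.-class of complex-valued measurable functions. -/
def fnorm {μ : Measure R} (ρ : (R → ℝ≥0∞) → ℝ≥0∞) (f : R →ₘ[μ] ℂ) : ℝ≥0∞ :=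
  ρ (fun x => ‖f x‖ₑ)

/-- The space `{f | ‖f‖ < ∞}` of a function norm. A function of finite (quasi-)norm is finite
almost everywhere, so its a.e.-class is a class of `ℂ`-valued functions. -/
def functionSpace (μ : Measure R) (ρ : (R → ℝ≥0∞) → ℝ≥0∞) : Set (R →ₘ[μ] ℂ) :=
  {f | fnorm ρ f < ∞}

/-- The topology that a quasinorm defines on its space: `U` is open if with each of its points it
contains a ball `{g | ‖g - f‖ < ε}`. -/
@[reducible]
def spaceTopology (μ : Measure R) (ρ : (R → ℝ≥0∞) → ℝ≥0∞) :
    TopologicalSpace (functionSpace μ ρ) where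
  IsOpen U := ∀ f ∈ U, ∃ ε : ℝ≥0, 0 < ε ∧
    ∀ g : functionSpace μ ρ, fnorm ρ (g.1 - f.1) < ε → g ∈ U
  isOpen_univ := fun _ _ => ⟨1, one_pos, fun _ _ => mem_univ _⟩
  isOpen_inter := by
    rintro U V hU hV f ⟨hfU, hfV⟩
    obtain ⟨a, ha, hU⟩ := hU f hfU
    obtain ⟨b, hb, hV⟩ := hV f hfV
    refine ⟨min a b, lt_min ha hb, fun g hg => ⟨hU g (hg.trans_le ?_), hV g (hg.trans_le ?_)⟩⟩
    · exact_mod_cast min_le_left a b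
    · exact_mod_cast min_le_right a b
  isOpen_sUnion := by
    rintro S hS f ⟨U, hUS, hfU⟩
    obtain ⟨a, ha, hU⟩ := hS U hUS f hfU
    exact ⟨a, ha, fun g hg => ⟨U, hUS, hU g hg⟩⟩

/-- `X ↪ Y` for the spaces `X`, `Y` of the functionals `ρ`, `σ`: `X ⊆ Y` and the identity map
`X → Y` is continuous. -/
def Embeds (μ : Measure R) (ρ σ : (R → ℝ≥0∞) → ℝ≥0∞) : Prop :=
  ∃ h : functionSpace μ ρ ⊆ functionSpace μ σ,
    Continuous[spaceTopology μ ρ, spaceTopology μ σ] (Set.inclusion h)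

/-! ### Lebesgue norms and Wiener--Luxemburg amalgams on `([0, ∞), λ)` -/

/-- Lebesgue measure on `[0, ∞)`. -/
def halfLine : Measure ℝ≥0 := (volume : Measure ℝ).comap (fun x : ℝ≥0 => (x : ℝ))

/-- The functional of `L^p` on `([0, ∞), λ)`. -/
def lebesgueNorm (p : ℝ≥0∞) (f : ℝ≥0 → ℝ≥0∞) : ℝ≥0∞ := eLpNorm f p halfLine

/-- The Wiener--Luxemburg functional `‖f^* χ_[0,1]‖_A + ‖f^* χ_(1,∞)‖_B`. -/
def WL (A B : (ℝ≥0 → ℝ≥0∞) → ℝ≥0∞) (f : ℝ≥0 → ℝ≥0∞) : ℝ≥0∞ :=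
  A ((Set.Icc 0 1).indicator (rearrangement halfLine f)) +
    B ((Set.Ioi 1).indicator (rearrangement halfLine f))

end WienerLuxemburg

end

open WienerLuxemburg

/-!
An r.i. functional `A` satisfies `A f = A f^*`, and `f^* = f^* χ_[0,1] + f^* χ_(1,∞)`, so all four
statements compare one of the two pieces of a non-increasing function `g` with `A`. On `[0,1]`,
`A (g χ_[0,1]) ≤ ‖g‖_∞ A (χ_[0,1])`. On `(1,∞)`, `g` is at most `g 1`, with
`g 1 * A (χ_[0,1]) ≤ A (g χ_[0,1])`, and is dominated by the step function
`∑ g (n + 1) χ_(n+1,n+2]`, whose pieces all have the quasinorm of `χ_[0,1]` up to the factor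
`g (n + 1)`; this bounds `A (g χ_(1,∞))` by an integral when `A` is subadditive.

That `A ⊆ WL(L¹,A)` forces (P5) is a gliding hump argument: were `f ↦ ∫_E f` not bounded by a
multiple of `A`, some series of functions of small quasinorm and large integral would have finite
quasinorm but infinite integral, whereas the Hardy–Littlewood inequality bounds `∫_E f` by the
integral of `f^*` over an interval.
-/

namespace WienerLuxemburg

/-! ### Lebesgue measure on the half-line -/

theorem measurableEmbedding_coe_nnreal : MeasurableEmbedding ((↑) : ℝ≥0 → ℝ) :=
  .subtype_coe measurableSet_Ici

theorem halfLine_apply (s : Set ℝ≥0) : halfLine s = volume (((↑) : ℝ≥0 → ℝ) '' s) :=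
  measurableEmbedding_coe_nnreal.comap_apply _ _

theorem halfLine_Ioc (a b : ℝ≥0) : halfLine (Ioc a b) = ((b - a : ℝ≥0) : ℝ≥0∞) := by
  rw [halfLine_apply, NNReal.image_coe_Ioc, Real.volume_Ioc, ENNReal.ofReal, NNReal.sub_def]

instance : NullSingletonClass halfLine := ⟨fun a => by simp [halfLine_apply]⟩

instance : SigmaFinite halfLine :=
  have : IsFiniteMeasureOnCompacts halfLine :=
    .comap' volume NNReal.continuous_coe measurableEmbedding_coe_nnreal
  inferInstance

theorem halfLine_Icc_zero (a : ℝ≥0) : halfLine (Icc 0 a) = a := by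
  rw [← measure_congr Ioc_ae_eq_Icc, halfLine_Ioc, tsub_zero]

theorem halfLine_Iio (a : ℝ≥0) : halfLine (Iio a) = a := by
  rw [measure_congr Iio_ae_eq_Iic, ← Icc_bot, bot_eq_zero, halfLine_Icc_zero]

theorem halfLine_univ : halfLine univ = ∞ :=
  ENNReal.eq_top_of_forall_nnreal_le fun r =>
    (halfLine_Iio r).symm.trans_le (measure_mono (subset_univ _))

theorem halfLine_coe_lt (c : ℝ≥0∞) : halfLine {t : ℝ≥0 | (t : ℝ≥0∞) < c} = c := by
  induction c with
  | top => simp [halfLine_univ]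
  | coe c =>
    simp only [ENNReal.coe_lt_coe]
    exact halfLine_Iio c

/-! ### Non-increasing functions on the half-line -/

section Antitone

variable {g : ℝ≥0 → ℝ≥0∞}

theorem monotone_add_natCast (a : ℝ≥0) : Monotone fun n : ℕ => a + n :=
  fun _ _ h => by simpa using h

theorem iUnion_Ioc_add_natCast (a : ℝ≥0) : ⋃ n : ℕ, Ioc (a + n) (a + n + 1) = Ioi a := by
  have hunbdd : ¬BddAbove (range fun n : ℕ => a + n) := by
    rintro ⟨b, hb⟩
    obtain ⟨n, hn⟩ := exists_nat_gt b
    exact (hn.trans_le le_add_self).not_ge (hb (mem_range_self n))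
  simpa [add_assoc] using
    iUnion_Ioc_map_succ_eq_Ioi (fun n => monotone_add_natCast a (Nat.zero_le n)) hunbdd

theorem pairwise_disjoint_Ioc_add_natCast (a : ℝ≥0) :
    Pairwise (Function.onFun Disjoint fun n : ℕ => Ioc (a + n) (a + n + 1)) := by
  simpa [add_assoc] using (monotone_add_natCast a).pairwise_disjoint_on_Ioc_succ

theorem indicator_Ioi_le_tsum_of_antitone (hg : Antitone g) (a t : ℝ≥0) :
    (Ioi a).indicator g t ≤
      ∑' n : ℕ, g (a + n) * (Ioc (a + n) (a + n + 1)).indicator (fun _ => 1) t := by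
  by_cases ht : t ∈ Ioi a
  · obtain ⟨n, hn⟩ := mem_iUnion.1 ((iUnion_Ioc_add_natCast a).symm ▸ ht)
    refine le_trans ?_ (ENNReal.le_tsum n)
    rw [indicator_of_mem ht, indicator_of_mem hn, mul_one]
    exact hg hn.1.le
  · simp [indicator_of_notMem ht]

theorem tsum_le_setLIntegral_Ioi_of_antitone (hg : Antitone g) (a : ℝ≥0) :
    ∑' n : ℕ, g (a + n + 1) ≤ ∫⁻ t in Ioi a, g t ∂halfLine := by
  rw [← iUnion_Ioc_add_natCast a,
    lintegral_iUnion (fun _ => measurableSet_Ioc) (pairwise_disjoint_Ioc_add_natCast a)]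
  refine ENNReal.tsum_le_tsum fun n => ?_
  simpa [halfLine_Ioc] using setLIntegral_mono' (μ := halfLine) (f := fun _ => g (a + n + 1))
    measurableSet_Ioc fun t (ht : t ∈ Ioc (a + n) (a + n + 1)) => hg ht.2

theorem le_setLIntegral_Icc_of_antitone (hg : Antitone g) :
    g 1 ≤ ∫⁻ t in Icc 0 1, g t ∂halfLine := by
  simpa [halfLine_Icc_zero] using setLIntegral_mono' (μ := halfLine) (f := fun _ => g 1)
    measurableSet_Icc fun t (ht : t ∈ Icc 0 1) => hg ht.2

theorem setLIntegral_le_mul_setLIntegral_Icc_of_antitone (hg : Antitone g) (c : ℝ≥0∞) :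
    ∫⁻ t in {t : ℝ≥0 | (t : ℝ≥0∞) < c}, g t ∂halfLine ≤
      (1 + c) * ∫⁻ t in Icc 0 1, g t ∂halfLine := by
  set J : Set ℝ≥0 := {t | (t : ℝ≥0∞) < c} with hJ
  have hcover : J ⊆ Icc 0 1 ∪ J ∩ Ioi 1 := fun t ht =>
    (le_or_gt t 1).imp (fun h => ⟨zero_le, h⟩) fun h => ⟨ht, h⟩
  have htail : ∫⁻ t in J ∩ Ioi 1, g t ∂halfLine ≤ c * g 1 := by
    calc ∫⁻ t in J ∩ Ioi 1, g t ∂halfLine ≤ ∫⁻ _ in J ∩ Ioi 1, g 1 ∂halfLine :=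
          setLIntegral_mono measurable_const fun t ht => hg ht.2.le
      _ = g 1 * halfLine (J ∩ Ioi 1) := setLIntegral_const _ _
      _ ≤ g 1 * halfLine J := by gcongr; exact inter_subset_left
      _ = c * g 1 := by rw [hJ, halfLine_coe_lt, mul_comm]
  calc ∫⁻ t in J, g t ∂halfLine ≤ ∫⁻ t in Icc 0 1 ∪ J ∩ Ioi 1, g t ∂halfLine :=
        lintegral_mono_set hcover
    _ ≤ ∫⁻ t in Icc 0 1, g t ∂halfLine + ∫⁻ t in J ∩ Ioi 1, g t ∂halfLine :=
        lintegral_union_le _ _ _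
    _ ≤ ∫⁻ t in Icc 0 1, g t ∂halfLine + c * ∫⁻ t in Icc 0 1, g t ∂halfLine := by
        gcongr
        exact htail.trans (by gcongr; exact le_setLIntegral_Icc_of_antitone hg)
    _ = (1 + c) * ∫⁻ t in Icc 0 1, g t ∂halfLine := by rw [add_mul, one_mul]

end Antitone

/-! ### Distribution functions and rearrangements -/

section Rearrangement

variable {R : Type*} [MeasurableSpace R] {μ : Measure R} {f g : R → ℝ≥0∞}

theorem distribution_antitone (μ : Measure R) (f : R → ℝ≥0∞) : Antitone (distribution μ f) :=
  fun _ _ hst => measure_mono fun _ hx => (ENNReal.coe_le_coe.2 hst).trans_lt hx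

theorem distribution_congr_ae (h : f =ᵐ[μ] g) : distribution μ f = distribution μ g := by
  funext s
  refine measure_congr ?_
  filter_upwards [h] with x hx
  exact congrArg ((s : ℝ≥0∞) < ·) hx

theorem distribution_indicator_one (E : Set R) (s : ℝ≥0) :
    distribution μ (E.indicator fun _ => 1) s = if s < 1 then μ E else 0 := by
  have hset : {x | (s : ℝ≥0∞) < E.indicator (fun _ => 1) x} = if s < 1 then E else ∅ := by
    ext x
    by_cases hx : x ∈ E <;> split_ifs with hs <;> simp [hx, hs]
  rw [distribution, hset]
  split_ifs <;> simp

/-- Right-continuity of the distribution function. -/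
theorem distribution_le_of_forall_gt {s : ℝ≥0} {c : ℝ≥0∞}
    (h : ∀ r, s < r → distribution μ f r ≤ c) : distribution μ f s ≤ c := by
  obtain ⟨u, hu_anti, hu_gt, hu_lim⟩ := exists_seq_strictAnti_tendsto s
  have hunion : {x | (s : ℝ≥0∞) < f x} = ⋃ n, {x | (u n : ℝ≥0∞) < f x} := by
    ext x
    rw [mem_iUnion]
    exact ⟨fun hx => ((ENNReal.tendsto_coe.2 hu_lim).eventually (gt_mem_nhds hx)).exists,
      fun ⟨n, hn⟩ => (ENNReal.coe_lt_coe.2 (hu_gt n)).trans hn⟩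
  have hmono : Monotone fun n => {x | (u n : ℝ≥0∞) < f x} := fun m n hmn x hx =>
    (ENNReal.coe_le_coe.2 (hu_anti.antitone hmn)).trans_lt hx
  rw [distribution, hunion, hmono.measure_iUnion]
  exact iSup_le fun n => h _ (hu_gt n)

theorem rearrangement_antitone (μ : Measure R) (f : R → ℝ≥0∞) : Antitone (rearrangement μ f) :=
  fun _ _ hst => iInf_mono fun _ =>
    iInf_mono' fun h => ⟨h.trans (ENNReal.coe_le_coe.2 hst), le_rfl⟩

theorem measurable_rearrangement (μ : Measure R) (f : R → ℝ≥0∞) :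
    Measurable (rearrangement μ f) :=
  (rearrangement_antitone μ f).measurable

theorem rearrangement_congr_ae (h : f =ᵐ[μ] g) : rearrangement μ f = rearrangement μ g := by
  funext t
  simp only [rearrangement, distribution_congr_ae h]

theorem lt_rearrangement_iff {s t : ℝ≥0} :
    (s : ℝ≥0∞) < rearrangement μ f t ↔ (t : ℝ≥0∞) < distribution μ f s := by
  rw [← not_le, ← not_le (b := (t : ℝ≥0∞)), not_iff_not]
  refine ⟨fun h => distribution_le_of_forall_gt fun r hr => ?_, fun h => iInf₂_le s h⟩
  obtain ⟨q, hq, hqr⟩ : ∃ q : ℝ≥0, ∃ _ : distribution μ f q ≤ t, (q : ℝ≥0∞) < r := by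
    simpa only [rearrangement, iInf_lt_iff] using h.trans_lt (ENNReal.coe_lt_coe.2 hr)
  exact (distribution_antitone μ f (ENNReal.coe_lt_coe.1 hqr).le).trans hq

theorem distribution_rearrangement (μ : Measure R) (f : R → ℝ≥0∞) :
    distribution halfLine (rearrangement μ f) = distribution μ f := by
  funext s
  simp only [distribution, lt_rearrangement_iff]
  exact halfLine_coe_lt _

/-- The layer cake formula `lintegral_eq_lintegral_meas_lt` for functions that may be infinite. -/
theorem lintegral_eq_lintegral_distribution [SFinite μ] (hf : AEMeasurable f μ) :
    ∫⁻ x, f x ∂μ = ∫⁻ s, distribution μ f s ∂halfLine := by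
  rw [lintegral_congr_ae hf.ae_eq_mk, distribution_congr_ae hf.ae_eq_mk]
  have hregion : MeasurableSet {p : R × ℝ≥0 | (p.2 : ℝ≥0∞) < hf.mk f p.1} :=
    measurableSet_lt (by fun_prop) (hf.measurable_mk.comp measurable_fst)
  have hsections := (Measure.prod_apply (μ := μ) (ν := halfLine) hregion).symm.trans
    (Measure.prod_apply_symm hregion)
  simpa only [distribution, preimage_ofPred_eq, halfLine_coe_lt] using hsections

/-- The Hardy–Littlewood inequality for a characteristic function. -/
theorem setLIntegral_le_setLIntegral_rearrangement [SFinite μ] (hf : AEMeasurable f μ)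
    (E : Set R) :
    ∫⁻ x in E, f x ∂μ ≤
      ∫⁻ t in {t : ℝ≥0 | (t : ℝ≥0∞) < μ E}, rearrangement μ f t ∂halfLine := by
  rw [lintegral_eq_lintegral_distribution hf.restrict,
    lintegral_eq_lintegral_distribution (measurable_rearrangement μ f).aemeasurable]
  refine lintegral_mono fun s => ?_
  calc distribution (μ.restrict E) f s ≤ min (distribution μ f s) (μ E) :=
        le_min (Measure.restrict_le_self _)
          ((measure_mono (subset_univ _)).trans_eq (Measure.restrict_apply_univ E))
    _ = halfLine ({t : ℝ≥0 | (t : ℝ≥0∞) < distribution μ f s} ∩ {t : ℝ≥0 | (t : ℝ≥0∞) < μ E}) := by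
        rw [← halfLine_coe_lt (min _ _)]
        simp only [lt_min_iff, ofPred_and]
    _ = distribution (halfLine.restrict {t : ℝ≥0 | (t : ℝ≥0∞) < μ E}) (rearrangement μ f) s := by
        rw [distribution.eq_def (halfLine.restrict _), Measure.restrict_apply
          (measurableSet_lt measurable_const (measurable_rearrangement μ f))]
        simp only [lt_rearrangement_iff]

end Rearrangement

theorem WL_congr_ae {A B : (ℝ≥0 → ℝ≥0∞) → ℝ≥0∞} {f g : ℝ≥0 → ℝ≥0∞} (h : f =ᵐ[halfLine] g) :
    WL A B f = WL A B g := by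
  simp only [WL, rearrangement_congr_ae h]

/-! ### Quasi-Banach function norms -/

section FunctionNorm

variable {R : Type*} [MeasurableSpace R] {μ : Measure R} {ρ σ : (R → ℝ≥0∞) → ℝ≥0∞}

/-- The quasi-triangle inequality with modulus `C`: the case `C = 1` is the subadditivity in (P1),
and (Q1) asks for some `C ≥ 1`. -/
def IsQuasiSubadditive (μ : Measure R) (C : ℝ≥0) (ρ : (R → ℝ≥0∞) → ℝ≥0∞) : Prop :=
  ∀ f g : R → ℝ≥0∞, AEMeasurable f μ → AEMeasurable g μ →
    ρ (fun x => f x + g x) ≤ C * (ρ f + ρ g)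

theorem HasP1.isQuasiSubadditive_one (h : HasP1 μ ρ) : IsQuasiSubadditive μ 1 ρ :=
  fun f g hf hg => by simpa using h.subadditive f g hf hg

theorem HasQ1.apply_zero (h : HasQ1 μ ρ) : ρ (fun _ => 0) = 0 :=
  (h.eq_zero_iff _ aemeasurable_const).2 .rfl

theorem HasP2.congr_ae (h : HasP2 μ ρ) {f g : R → ℝ≥0∞} (hf : AEMeasurable f μ)
    (hg : AEMeasurable g μ) (hfg : f =ᵐ[μ] g) : ρ f = ρ g :=
  (h f g hf hg hfg.le).antisymm (h g f hg hf hfg.symm.le)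

theorem HasP2.apply_indicator_le (h : HasP2 μ ρ) {f : R → ℝ≥0∞} (hf : AEMeasurable f μ)
    {E : Set R} (hE : MeasurableSet E) : ρ (E.indicator f) ≤ ρ f :=
  h _ _ (hf.indicator hE) hf (.of_forall (indicator_le_self _ _))

namespace IsQuasiSubadditive

variable {C : ℝ≥0}

theorem le_indicator_add_indicator_compl (hC : IsQuasiSubadditive μ C ρ) {f : R → ℝ≥0∞}
    (hf : AEMeasurable f μ) {E : Set R} (hE : MeasurableSet E) :
    ρ f ≤ C * (ρ (E.indicator f) + ρ (Eᶜ.indicator f)) := by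
  simpa only [indicator_self_add_compl_apply] using
    hC _ _ (hf.indicator hE) (hf.indicator hE.compl)

theorem sum_range_le (hC : IsQuasiSubadditive μ C ρ) (h0 : ρ (fun _ => 0) = 0)
    {f : ℕ → R → ℝ≥0∞} (hf : ∀ n, AEMeasurable (f n) μ) (n : ℕ) :
    ρ (fun x => ∑ i ∈ Finset.range n, f i x) ≤
      ∑ i ∈ Finset.range n, (C : ℝ≥0∞) ^ (i + 1) * ρ (f i) := by
  induction n generalizing f with
  | zero => simp [h0]
  | succ n ih =>
    simp only [Finset.sum_range_succ', zero_add, pow_one]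
    calc ρ (fun x => ∑ i ∈ Finset.range n, f (i + 1) x + f 0 x)
        ≤ C * (ρ (fun x => ∑ i ∈ Finset.range n, f (i + 1) x) + ρ (f 0)) :=
          hC _ _ (Finset.aemeasurable_fun_sum _ fun i _ => hf _) (hf 0)
      _ ≤ C * (∑ i ∈ Finset.range n, (C : ℝ≥0∞) ^ (i + 1) * ρ (f (i + 1)) + ρ (f 0)) := by
          gcongr
          exact ih fun i => hf _
      _ = ∑ i ∈ Finset.range n, (C : ℝ≥0∞) ^ (i + 1 + 1) * ρ (f (i + 1)) + C * ρ (f 0) := by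
          simp only [mul_add, Finset.mul_sum, pow_succ' _ (_ + 1), mul_assoc]

theorem tsum_le (hC : IsQuasiSubadditive μ C ρ) (h0 : ρ (fun _ => 0) = 0) (h3 : HasP3 μ ρ)
    {f : ℕ → R → ℝ≥0∞} (hf : ∀ n, AEMeasurable (f n) μ) :
    ρ (fun x => ∑' n, f n x) ≤ ∑' n, (C : ℝ≥0∞) ^ (n + 1) * ρ (f n) := by
  have hlim := (h3 (fun n x => ∑ i ∈ Finset.range n, f i x) (fun x => ∑' n, f n x)
    (fun n => Finset.aemeasurable_fun_sum _ fun i _ => hf _) (.tsum hf)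
    (.of_forall fun x => ⟨fun m n hmn => Finset.sum_le_sum_of_subset (Finset.range_mono hmn),
      ENNReal.summable.hasSum.tendsto_sum_nat⟩)).2
  exact le_of_tendsto hlim (.of_forall fun n =>
    (hC.sum_range_le h0 hf n).trans (ENNReal.sum_le_tsum _))

end IsQuasiSubadditive

theorem HasQ1.exists_eq_and_lt_of_mul_lt (hρ : HasQ1 μ ρ) (h2 : HasP2 μ σ)
    (hσ : ∀ (a : ℝ≥0) (f : R → ℝ≥0∞), AEMeasurable f μ → σ (fun x => a * f x) = a * σ f)
    {f : R → ℝ≥0∞} (hf : AEMeasurable f μ) {δ N : ℝ≥0} (hδ : 0 < δ) (hN : 0 < N)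
    (h : ((N / δ : ℝ≥0) : ℝ≥0∞) * ρ f < σ f) :
    ∃ g : R → ℝ≥0∞, AEMeasurable g μ ∧ ρ g = δ ∧ N < σ g := by
  have hfin : ρ f ≠ ∞ := fun hf_top => by
    rw [hf_top, ENNReal.mul_top (by exact_mod_cast (div_pos hN hδ).ne')] at h
    exact not_top_lt h
  obtain ⟨r, hr⟩ : ∃ r : ℝ≥0, r = ρ f := ⟨_, ENNReal.coe_toNNReal hfin⟩
  have hpos : 0 < r := pos_iff_ne_zero.2 fun hr0 => by
    have hf0 : f =ᵐ[μ] fun x => ((0 : ℝ≥0) : ℝ≥0∞) * f x := by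
      simp only [ENNReal.coe_zero, zero_mul]
      exact (hρ.eq_zero_iff f hf).1 (by simp [← hr, hr0])
    rw [h2.congr_ae hf (hf.const_mul _) hf0, hσ 0 f hf] at h
    simp at h
  refine ⟨fun x => ((δ / r : ℝ≥0) : ℝ≥0∞) * f x, hf.const_mul _, ?_, ?_⟩
  · rw [hρ.homogeneous _ f hf, ← hr, ← ENNReal.coe_mul, div_mul_cancel₀ _ hpos.ne']
  · have hN_eq : N = δ / r * (N / δ * r) := by field_simp
    calc (N : ℝ≥0∞) = ((δ / r : ℝ≥0) : ℝ≥0∞) * (((N / δ : ℝ≥0) : ℝ≥0∞) * ρ f) := by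
          rw [← hr]
          exact_mod_cast hN_eq
      _ < ((δ / r : ℝ≥0) : ℝ≥0∞) * σ f :=
          ENNReal.mul_lt_mul_right (by exact_mod_cast (div_pos hδ hpos).ne') ENNReal.coe_ne_top h
      _ = σ (fun x => ((δ / r : ℝ≥0) : ℝ≥0∞) * f x) := (hσ _ f hf).symm

theorem Embeds.of_le_mul {K : ℝ≥0∞} (hK : K ≠ ∞)
    (h : ∀ f : R → ℝ≥0∞, AEMeasurable f μ → σ f ≤ K * ρ f) : Embeds μ ρ σ := by
  have hle (f : R →ₘ[μ] ℂ) : fnorm σ f ≤ K * fnorm ρ f := h _ f.aestronglyMeasurable.enorm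
  refine ⟨fun f hf => (hle f).trans_lt (ENNReal.mul_lt_top hK.lt_top hf), ?_⟩
  refine (@continuous_def _ _ (spaceTopology μ ρ) (spaceTopology μ σ) _).2 fun U hU f hf => ?_
  obtain ⟨ε, hε, hball⟩ := hU _ hf
  obtain ⟨δ, hδ, hδε⟩ := ENNReal.exists_nnreal_pos_mul_lt hK (ENNReal.coe_pos.2 hε).ne'
  refine ⟨δ, hδ, fun g hg => hball _ ?_⟩
  calc fnorm σ (g.1 - f.1) ≤ K * fnorm ρ (g.1 - f.1) := hle _
    _ ≤ δ * K := by rw [mul_comm]; gcongr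
    _ < ε := hδε

namespace IsQuasiBanachFunctionNorm

theorem const_mul (hρ : IsQuasiBanachFunctionNorm μ ρ) (c : ℝ≥0∞) {f : R → ℝ≥0∞}
    (hf : AEMeasurable f μ) : ρ (fun x => c * f x) = c * ρ f := by
  induction c with
  | coe c => exact hρ.q1.homogeneous c f hf
  | top =>
    have hlim (y : ℝ≥0∞) : Tendsto (fun n : ℕ => ((n : ℝ≥0) : ℝ≥0∞) * y) atTop (𝓝 (∞ * y)) := by
      simpa using ENNReal.Tendsto.mul_const ENNReal.tendsto_nat_nhds_top (.inl ENNReal.top_ne_zero)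
    have hρlim := (hρ.p3 (fun n x => ((n : ℝ≥0) : ℝ≥0∞) * f x) (fun x => ∞ * f x)
      (fun n => hf.const_mul _) (hf.const_mul _) (.of_forall fun x => ⟨fun m n hmn =>
        mul_le_mul_left (by exact_mod_cast hmn) _, hlim _⟩)).2
    simp only [hρ.q1.homogeneous _ f hf] at hρlim
    exact tendsto_nhds_unique hρlim (hlim _)

theorem mul_apply_indicator_one_le (hρ : IsQuasiBanachFunctionNorm μ ρ) {c : ℝ≥0∞}
    {f : R → ℝ≥0∞} (hf : AEMeasurable f μ) {E : Set R} (hE : NullMeasurableSet E μ)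
    (h : ∀ x ∈ E, c ≤ f x) : c * ρ (E.indicator fun _ => 1) ≤ ρ f := by
  have hχ : AEMeasurable (E.indicator fun _ => (1 : ℝ≥0∞)) μ := aemeasurable_const.indicator₀ hE
  rw [← hρ.const_mul c hχ]
  refine hρ.p2 _ _ (hχ.const_mul c) hf (.of_forall fun x => ?_)
  by_cases hx : x ∈ E
  · simpa [hx] using h x hx
  · simp [hx]

theorem apply_indicator_le_eLpNorm_top_mul (hρ : IsQuasiBanachFunctionNorm μ ρ) {f : R → ℝ≥0∞}
    (hf : AEMeasurable f μ) {E : Set R} (hE : MeasurableSet E) :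
    ρ (E.indicator f) ≤ eLpNorm (E.indicator f) ∞ μ * ρ (E.indicator fun _ => 1) := by
  have hχ : AEMeasurable (E.indicator fun _ => (1 : ℝ≥0∞)) μ := aemeasurable_const.indicator hE
  rw [← hρ.const_mul _ hχ, eLpNorm_exponent_top]
  refine hρ.p2 _ _ (hf.indicator hE) (hχ.const_mul _) ?_
  have hbound : ∀ᵐ x ∂μ, E.indicator f x ≤ eLpNormEssSup (E.indicator f) μ := ae_le_eLpNormEssSup
  filter_upwards [hbound] with x hle
  by_cases hx : x ∈ E
  · simpa only [indicator_of_mem hx, mul_one] using hle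
  · simp [hx]

theorem ae_lt_top (hρ : IsQuasiBanachFunctionNorm μ ρ) {f : R → ℝ≥0∞} (hf : AEMeasurable f μ)
    (hfin : ρ f < ∞) : ∀ᵐ x ∂μ, f x < ∞ := by
  have hS : NullMeasurableSet (f ⁻¹' {∞}) μ := hf.nullMeasurable (measurableSet_singleton ∞)
  have hle : ∞ * ρ ((f ⁻¹' {∞}).indicator fun _ => 1) ≤ ρ f :=
    hρ.mul_apply_indicator_one_le hf hS fun x hx => (show f x = ∞ from hx).ge
  have hzero : ρ ((f ⁻¹' {∞}).indicator fun _ => 1) = 0 := by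
    by_contra hne
    exact (ENNReal.top_mul hne ▸ hle).not_gt hfin
  filter_upwards [(hρ.q1.eq_zero_iff _ (aemeasurable_const.indicator₀ hS)).1 hzero] with x hx
  simpa [lt_top_iff_ne_top] using hx

/-- This extends an inclusion of spaces, which only concerns classes of `ℂ`-valued functions, to
`[0, ∞]`-valued functions. -/
theorem lt_top_of_functionSpace_subset (hρ : IsQuasiBanachFunctionNorm μ ρ)
    (hσ : ∀ f g : R → ℝ≥0∞, f =ᵐ[μ] g → σ f = σ g) (h : functionSpace μ ρ ⊆ functionSpace μ σ)
    {f : R → ℝ≥0∞} (hf : AEMeasurable f μ) (hfin : ρ f < ∞) : σ f < ∞ := by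
  have hm : AEStronglyMeasurable (fun x => ((f x).toReal : ℂ)) μ :=
    (Complex.measurable_ofReal.comp_aemeasurable hf.ennreal_toReal).aestronglyMeasurable
  set g : R →ₘ[μ] ℂ := AEEqFun.mk _ hm
  have hgf : (fun x => ‖g x‖ₑ) =ᵐ[μ] f := by
    filter_upwards [AEEqFun.coeFn_mk _ hm, hρ.ae_lt_top hf hfin] with x hgx hfx
    rw [hgx, ← ofReal_norm, Complex.norm_real, Real.norm_of_nonneg ENNReal.toReal_nonneg,
      ENNReal.ofReal_toReal hfx.ne]
  have hg : g ∈ functionSpace μ ρ :=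
    (hρ.p2.congr_ae g.aestronglyMeasurable.enorm hf hgf).trans_lt hfin
  exact (hσ _ _ hgf).symm.trans_lt (h hg)

theorem exists_le_mul_of_forall_lt_top (hρ : IsQuasiBanachFunctionNorm μ ρ) (h2 : HasP2 μ σ)
    (hσ : ∀ (a : ℝ≥0) (f : R → ℝ≥0∞), AEMeasurable f μ → σ (fun x => a * f x) = a * σ f)
    (h : ∀ f : R → ℝ≥0∞, AEMeasurable f μ → ρ f < ∞ → σ f < ∞) :
    ∃ K : ℝ≥0, ∀ f : R → ℝ≥0∞, AEMeasurable f μ → σ f ≤ K * ρ f := by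
  by_contra! hunbounded
  obtain ⟨C, -, hC⟩ : ∃ C : ℝ≥0, 1 ≤ C ∧ IsQuasiSubadditive μ C ρ := hρ.q1.quasi_subadditive
  obtain ⟨δ, hδ, hsum⟩ := ENNReal.exists_pos_tsum_mul_lt_of_countable one_ne_zero
    (fun n : ℕ => (C : ℝ≥0∞) ^ (n + 1)) fun n => ENNReal.pow_ne_top ENNReal.coe_ne_top
  have hhump (n : ℕ) : ∃ g : R → ℝ≥0∞, AEMeasurable g μ ∧ ρ g = δ n ∧ (n + 1 : ℝ≥0) < σ g := by
    obtain ⟨f, hf, hlt⟩ := hunbounded ((n + 1) / δ n)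
    exact hρ.q1.exists_eq_and_lt_of_mul_lt h2 hσ hf (hδ n) (by positivity) hlt
  choose g hgm hgρ hgσ using hhump
  have hfinite : ρ (fun x => ∑' n, g n x) < ∞ := by
    refine (hC.tsum_le hρ.q1.apply_zero hρ.p3 hgm).trans_lt ?_
    simpa only [hgρ] using hsum.trans ENNReal.one_lt_top
  have hlarge (n : ℕ) : (n : ℝ≥0∞) ≤ σ (fun x => ∑' n, g n x) :=
    calc (n : ℝ≥0∞) ≤ (n + 1 : ℝ≥0) := by push_cast; exact le_self_add
      _ ≤ σ (g n) := (hgσ n).le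
      _ ≤ σ (fun x => ∑' n, g n x) :=
        h2 _ _ (hgm n) (.tsum hgm) (.of_forall fun x => ENNReal.le_tsum (f := fun n => g n x) n)
  obtain ⟨n, hn⟩ := ENNReal.exists_nat_gt (h _ (.tsum hgm) hfinite).ne
  exact (hlarge n).not_gt hn

end IsQuasiBanachFunctionNorm

end FunctionNorm

/-! ### Rearrangement-invariant norms on the half-line -/

/-- The fundamental function `t ↦ ‖χ_[0,t]‖` of a functional on `([0, ∞), λ)`. If the functional is
rearrangement-invariant, this is the norm of the characteristic function of any set of
measure `t`. -/
noncomputable def fundamentalFunction (A : (ℝ≥0 → ℝ≥0∞) → ℝ≥0∞) (t : ℝ≥0) : ℝ≥0∞ :=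
  A ((Icc 0 t).indicator fun _ => 1)

theorem HasP4.fundamentalFunction_ne_top {A : (ℝ≥0 → ℝ≥0∞) → ℝ≥0∞} (h : HasP4 halfLine A)
    (t : ℝ≥0) : fundamentalFunction A t ≠ ∞ :=
  (h _ measurableSet_Icc (by simp [halfLine_Icc_zero])).ne

theorem HasQ1.fundamentalFunction_ne_zero {A : (ℝ≥0 → ℝ≥0∞) → ℝ≥0∞} (h : HasQ1 halfLine A)
    {t : ℝ≥0} (ht : t ≠ 0) : fundamentalFunction A t ≠ 0 := by
  intro hzero
  have hae := (h.eq_zero_iff _ (aemeasurable_const.indicator measurableSet_Icc)).1 hzero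
  rw [indicator_ae_eq_zero, Function.support_const one_ne_zero, inter_univ,
    halfLine_Icc_zero] at hae
  exact ht (ENNReal.coe_eq_zero.1 hae)

theorem IsQuasiBanachFunctionNorm.mul_fundamentalFunction_le {A : (ℝ≥0 → ℝ≥0∞) → ℝ≥0∞}
    (hA : IsQuasiBanachFunctionNorm halfLine A) {g : ℝ≥0 → ℝ≥0∞} (hg : Antitone g) (t : ℝ≥0) :
    g t * fundamentalFunction A t ≤ A ((Icc 0 t).indicator g) :=
  hA.mul_apply_indicator_one_le (hg.measurable.indicator measurableSet_Icc).aemeasurable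
    measurableSet_Icc.nullMeasurableSet fun s hs => by
      simpa only [indicator_of_mem hs] using hg hs.2

namespace IsRIQuasiBanachFunctionNorm

variable {A : (ℝ≥0 → ℝ≥0∞) → ℝ≥0∞} {f : ℝ≥0 → ℝ≥0∞}

theorem apply_rearrangement (hA : IsRIQuasiBanachFunctionNorm halfLine A)
    (hf : AEMeasurable f halfLine) : A (rearrangement halfLine f) = A f :=
  hA.rearrangement_invariant _ _ (measurable_rearrangement _ f).aemeasurable hf
    (distribution_rearrangement _ f)

theorem apply_indicator_rearrangement_le (hA : IsRIQuasiBanachFunctionNorm halfLine A)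
    (hf : AEMeasurable f halfLine) {E : Set ℝ≥0} (hE : MeasurableSet E) :
    A (E.indicator (rearrangement halfLine f)) ≤ A f :=
  (hA.p2.apply_indicator_le (measurable_rearrangement _ f).aemeasurable hE).trans_eq
    (hA.apply_rearrangement hf)

theorem apply_indicator_one (hA : IsRIQuasiBanachFunctionNorm halfLine A) {E : Set ℝ≥0}
    (hE : MeasurableSet E) {t : ℝ≥0} (ht : halfLine E = t) :
    A (E.indicator fun _ => 1) = fundamentalFunction A t := by
  refine hA.rearrangement_invariant _ _ (aemeasurable_const.indicator hE)
    (aemeasurable_const.indicator measurableSet_Icc) ?_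
  funext s
  rw [distribution_indicator_one, distribution_indicator_one, ht, halfLine_Icc_zero]

theorem le_mul_WL_self (hA : IsRIQuasiBanachFunctionNorm halfLine A) {C : ℝ≥0}
    (hC : IsQuasiSubadditive halfLine C A) (hf : AEMeasurable f halfLine) :
    A f ≤ C * WL A A f := by
  have hcompl : (Icc (0 : ℝ≥0) 1)ᶜ = Ioi 1 := by rw [← bot_eq_zero, Icc_bot, compl_Iic]
  rw [← hA.apply_rearrangement hf, WL, ← hcompl]
  exact hC.le_indicator_add_indicator_compl (measurable_rearrangement _ f).aemeasurable
    measurableSet_Icc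

theorem apply_indicator_Ioi_le (hA : IsRIQuasiBanachFunctionNorm halfLine A)
    (h1 : HasP1 halfLine A) {g : ℝ≥0 → ℝ≥0∞} (hg : Antitone g) (a : ℝ≥0) :
    A ((Ioi a).indicator g) ≤
      (g a + ∫⁻ t in Ioi a, g t ∂halfLine) * fundamentalFunction A 1 := by
  set χ : ℕ → ℝ≥0 → ℝ≥0∞ := fun n => (Ioc (a + n) (a + n + 1)).indicator fun _ => 1
  have hχm (n : ℕ) : AEMeasurable (χ n) halfLine := aemeasurable_const.indicator measurableSet_Ioc
  have hχA (n : ℕ) : A (χ n) = fundamentalFunction A 1 :=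
    hA.apply_indicator_one measurableSet_Ioc (by rw [halfLine_Ioc, add_tsub_cancel_left])
  have hm (n : ℕ) : AEMeasurable (fun t => g (a + n) * χ n t) halfLine := (hχm n).const_mul _
  calc A ((Ioi a).indicator g) ≤ A (fun t => ∑' n : ℕ, g (a + n) * χ n t) :=
        hA.p2 _ _ (hg.measurable.indicator measurableSet_Ioi).aemeasurable (.tsum hm)
          (.of_forall (indicator_Ioi_le_tsum_of_antitone hg a))
    _ ≤ ∑' n : ℕ, A (fun t => g (a + n) * χ n t) := by
        simpa using h1.isQuasiSubadditive_one.tsum_le hA.q1.apply_zero hA.p3 hm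
    _ = (∑' n : ℕ, g (a + n)) * fundamentalFunction A 1 := by
        simp only [hA.const_mul _ (hχm _), hχA, ENNReal.tsum_mul_right]
    _ = (g a + ∑' n : ℕ, g (a + n + 1)) * fundamentalFunction A 1 := by
        rw [tsum_eq_zero_add' ENNReal.summable]
        simp [add_assoc]
    _ ≤ (g a + ∫⁻ t in Ioi a, g t ∂halfLine) * fundamentalFunction A 1 := by
        gcongr
        exact tsum_le_setLIntegral_Ioi_of_antitone hg a

end IsRIQuasiBanachFunctionNorm

/-! ### Embeddings of Wiener–Luxemburg amalgams -/

theorem lebesgueNorm_one_indicator {E : Set ℝ≥0} (hE : MeasurableSet E) (f : ℝ≥0 → ℝ≥0∞) :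
    lebesgueNorm 1 (E.indicator f) = ∫⁻ t in E, f t ∂halfLine := by
  simp [lebesgueNorm, eLpNorm_one_eq_lintegral_enorm, lintegral_indicator hE]

theorem lebesgueNorm_top_indicator_Ioi_le {g : ℝ≥0 → ℝ≥0∞} (hg : Antitone g) (a : ℝ≥0) :
    lebesgueNorm ∞ ((Ioi a).indicator g) ≤ g a := by
  rw [lebesgueNorm, eLpNorm_exponent_top]
  exact essSup_le_of_ae_le _ (.of_forall (indicator_le fun t ht => hg (le_of_lt ht)))

namespace IsRIQuasiBanachFunctionNorm

variable {A : (ℝ≥0 → ℝ≥0∞) → ℝ≥0∞}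

theorem WL_top_embeds (hA : IsRIQuasiBanachFunctionNorm halfLine A) :
    Embeds halfLine (WL (lebesgueNorm ∞) A) A := by
  obtain ⟨C, -, hC⟩ : ∃ C : ℝ≥0, 1 ≤ C ∧ IsQuasiSubadditive halfLine C A :=
    hA.q1.quasi_subadditive
  set φ := fundamentalFunction A 1
  have hK : C * (φ + 1) ≠ ∞ := ENNReal.mul_ne_top ENNReal.coe_ne_top
    (ENNReal.add_ne_top.2 ⟨hA.p4.fundamentalFunction_ne_top 1, ENNReal.one_ne_top⟩)
  refine .of_le_mul hK fun f hf => ?_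
  set u := (Icc 0 1).indicator (rearrangement halfLine f)
  set v := (Ioi 1).indicator (rearrangement halfLine f)
  have hu : A u ≤ lebesgueNorm ∞ u * φ := hA.apply_indicator_le_eLpNorm_top_mul
    (measurable_rearrangement _ f).aemeasurable measurableSet_Icc
  calc A f ≤ C * (A u + A v) := hA.le_mul_WL_self hC hf
    _ ≤ C * ((φ + 1) * lebesgueNorm ∞ u + (φ + 1) * A v) := by
        gcongr
        · exact hu.trans (by rw [mul_comm]; gcongr; exact le_self_add)
        · exact le_mul_of_one_le_left' le_add_self
    _ = C * (φ + 1) * WL (lebesgueNorm ∞) A f := by rw [← mul_add, ← mul_assoc]; rfl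

theorem WL_one_embeds (hA : IsRIQuasiBanachFunctionNorm halfLine A) (h1 : HasP1 halfLine A) :
    Embeds halfLine (WL A (lebesgueNorm 1)) A := by
  set φ := fundamentalFunction A 1
  have hK : 2 + φ ≠ ∞ :=
    ENNReal.add_ne_top.2 ⟨ENNReal.ofNat_ne_top, hA.p4.fundamentalFunction_ne_top 1⟩
  refine .of_le_mul hK fun f hf => ?_
  have hanti := rearrangement_antitone halfLine f
  set u := (Icc 0 1).indicator (rearrangement halfLine f)
  set v := (Ioi 1).indicator (rearrangement halfLine f)
  have hv : A v ≤ A u + φ * lebesgueNorm 1 v := by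
    rw [lebesgueNorm_one_indicator measurableSet_Ioi]
    refine (hA.apply_indicator_Ioi_le h1 hanti 1).trans ?_
    rw [add_mul, mul_comm φ]
    gcongr
    exact hA.mul_fundamentalFunction_le hanti 1
  calc A f ≤ A u + A v := by simpa [WL] using hA.le_mul_WL_self h1.isQuasiSubadditive_one hf
    _ ≤ 2 * A u + φ * lebesgueNorm 1 v := by rw [two_mul, add_assoc]; gcongr
    _ ≤ (2 + φ) * A u + (2 + φ) * lebesgueNorm 1 v := by
        gcongr
        · exact le_self_add
        · exact le_add_self
    _ = (2 + φ) * WL A (lebesgueNorm 1) f := (mul_add _ _ _).symm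

theorem embeds_WL_top (hA : IsRIQuasiBanachFunctionNorm halfLine A) :
    Embeds halfLine A (WL A (lebesgueNorm ∞)) := by
  set φ := fundamentalFunction A 1
  have hφ0 : φ ≠ 0 := hA.q1.fundamentalFunction_ne_zero one_ne_zero
  have hφt : φ ≠ ∞ := hA.p4.fundamentalFunction_ne_top 1
  have hK : 1 + φ⁻¹ ≠ ∞ :=
    ENNReal.add_ne_top.2 ⟨ENNReal.one_ne_top, ENNReal.inv_ne_top.2 hφ0⟩
  refine .of_le_mul hK fun f hf => ?_
  have hanti := rearrangement_antitone halfLine f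
  have hu : A ((Icc 0 1).indicator (rearrangement halfLine f)) ≤ A f :=
    hA.apply_indicator_rearrangement_le hf measurableSet_Icc
  have hone : rearrangement halfLine f 1 ≤ A f / φ :=
    (ENNReal.le_div_iff_mul_le (.inl hφ0) (.inl hφt)).2
      ((hA.mul_fundamentalFunction_le hanti 1).trans hu)
  calc WL A (lebesgueNorm ∞) f ≤ A f + A f / φ :=
        add_le_add hu ((lebesgueNorm_top_indicator_Ioi_le hanti 1).trans hone)
    _ = (1 + φ⁻¹) * A f := by rw [add_mul, one_mul, div_eq_mul_inv, mul_comm φ⁻¹]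

theorem embeds_WL_one (hA : IsRIQuasiBanachFunctionNorm halfLine A) (h5 : HasP5 halfLine A) :
    Embeds halfLine A (WL (lebesgueNorm 1) A) := by
  obtain ⟨C, hC⟩ := h5 (Icc 0 1) measurableSet_Icc (by simp [halfLine_Icc_zero])
  refine .of_le_mul (ENNReal.coe_ne_top (r := C + 1)) fun f hf => ?_
  have hu : lebesgueNorm 1 ((Icc 0 1).indicator (rearrangement halfLine f)) ≤ C * A f := by
    rw [lebesgueNorm_one_indicator measurableSet_Icc, ← hA.apply_rearrangement hf]
    exact hC _ (measurable_rearrangement _ f).aemeasurable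
  calc WL (lebesgueNorm 1) A f ≤ C * A f + A f :=
        add_le_add hu (hA.apply_indicator_rearrangement_le hf measurableSet_Ioi)
    _ = ((C + 1 : ℝ≥0) : ℝ≥0∞) * A f := by push_cast; rw [add_mul, one_mul]

end IsRIQuasiBanachFunctionNorm

theorem IsQuasiBanachFunctionNorm.hasP5_of_functionSpace_subset {A : (ℝ≥0 → ℝ≥0∞) → ℝ≥0∞}
    (hA : IsQuasiBanachFunctionNorm halfLine A)
    (h : functionSpace halfLine A ⊆ functionSpace halfLine (WL (lebesgueNorm 1) A)) :
    HasP5 halfLine A := by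
  intro E _ hE
  refine hA.exists_le_mul_of_forall_lt_top
    (fun f g _ _ hfg => lintegral_mono_ae (ae_restrict_of_ae hfg))
    (fun a f hf => lintegral_const_mul'' _ hf.restrict) fun f hf hfin => ?_
  have hWL : WL (lebesgueNorm 1) A f < ∞ :=
    hA.lt_top_of_functionSpace_subset (fun _ _ => WL_congr_ae) h hf hfin
  have hIcc : ∫⁻ t in Icc 0 1, rearrangement halfLine f t ∂halfLine < ∞ := by
    rw [← lebesgueNorm_one_indicator measurableSet_Icc]
    exact le_self_add.trans_lt hWL
  calc ∫⁻ x in E, f x ∂halfLine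
      ≤ ∫⁻ t in {t : ℝ≥0 | (t : ℝ≥0∞) < halfLine E}, rearrangement halfLine f t ∂halfLine :=
        setLIntegral_le_setLIntegral_rearrangement hf E
    _ ≤ (1 + halfLine E) * ∫⁻ t in Icc 0 1, rearrangement halfLine f t ∂halfLine :=
        setLIntegral_le_mul_setLIntegral_Icc_of_antitone (rearrangement_antitone _ f) _
    _ < ∞ := ENNReal.mul_lt_top (ENNReal.add_lt_top.2 ⟨ENNReal.one_lt_top, hE⟩) hIcc

end WienerLuxemburg

theorem mainTheorem10 (A : (ℝ≥0 → ℝ≥0∞) → ℝ≥0∞)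
    (hA : IsRIQuasiBanachFunctionNorm halfLine A) :
    Embeds halfLine (WL (lebesgueNorm ∞) A) A ∧
    (HasP1 halfLine A → Embeds halfLine (WL A (lebesgueNorm 1)) A) ∧
    (Embeds halfLine A (WL (lebesgueNorm 1) A) ↔ HasP5 halfLine A) ∧
    Embeds halfLine A (WL A (lebesgueNorm ∞)) :=
  ⟨hA.WL_top_embeds, hA.WL_one_embeds,
    ⟨fun ⟨hsubset, _⟩ => hA.hasP5_of_functionSpace_subset hsubset, hA.embeds_WL_one⟩,
    hA.embeds_WL_top⟩
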